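/- Let $\mathsf X,\mathsf U$ be finite sets, let $K(y|x,u)$ be a Markov transition law from $\mathsf X\times\mathsf U$ to $\mathsf X$, and let $$\mathcal G=\Big\{\nu\in\mathcal P(\mathsf X\times\mathsf U):\ \sum_{x,u}K(y|x,u)\nu(x,u)=\sum_u\nu(y,u)\ \text{ for all } y\in\mathsf X\Big\}\subset\mathbb R^{\mathsf X\times\mathsf U}$$ be its state-action polytope. Write $\langle\cdot,\cdot\rangle$ for the standard inner product, $\mathrm{ri}(\mathcal G)$ for the relative interior of $\mathcal G$, and $V\subseteq\mathbb R^{\mathsf X\times\mathsf U}$ for the linear subspace parallel to the affine hull of $\mathcal G$. For a function $F:\mathrm{ri}(\mathcal G)\to\mathbb R$ the derivatives $\nabla F(\nu)\in V$, $\nabla^2F(\nu)$ and $\nabla^3F(\nu)$ are taken along $V$. Put $$F^*(h)=\sup_{v\in \mathrm{ri}(\mathcal G)}\{\langle h,v\rangle-F(v)\},\quad h\in\mathbb R^{\mathsf X\times\mathsf U},\qquad \|f\|^*_h=\sqrt{\nabla^2F^*(h)[f,f]},$$ $$D_F(v,w)=F(v)-F(w)-\langle\nabla F(w),v-w\rangle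 ,\qquad v,w\in\mathrm{ri}(\mathcal G).$$ Assume that $F$ is a self-concordant barrier on $\mathcal G$, i.e. $F$ is convex and $C^3$ on $\mathrm{ri}(\mathcal G)$, satisfies $\nabla^3F(v)[h,h,h]\le 2(\nabla^2F(v)[h,h])^{3/2}$ for all $v\in\mathrm{ri}(\mathcal G)$, $h\in V$, and $F(v)\to+\infty$ whenever $v\in\mathrm{ri}(\mathcal G)$ converges to a relative boundary point of $\mathcal G$. Assume moreover that $F$ is strictly convex on $\mathrm{ri}(\mathcal G)$ and $F^*$ is strictly convex on $V$; that $\nu\mapsto\nabla F(\nu)$ is a bijection from $\mathrm{ri}(\mathcal G)$ onto $V$ whose inverse is $h\mapsto\nabla F^*(h)$; and that the minimum value of $F$ on $\mathrm{ri}(\mathcal G)$ is $0$. Let $\mathcal G'\subseteq\mathrm{ri}(\mathcal G)$, let $\rho>0$, let $T$ be a natural number, and let $f_1,f_2,\ldots:\mathsf X\times\mathsf U\to\mathbb R$ be arbitrary cost functions. Let $\nu_1=\arg\min_{\nu\in\mathrm{ri}(\mathcal G)}F(\nu)$ and $\nu_{t+1}=\nabla F^*(\nabla F(\nu_t)-\rho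 f_t)$ for $t\ge1$. Suppose that for all $t=1,\ldots,T$ $$\rho\,\|f_t\|^*_{\nabla F(\nu_t)}\le\tfrac12\qquad\text{and}\qquad\|f_t\|^*_{\nabla F(\nu_t)}\le1 .$$ Then, with $D_F(\mathcal G')=\sup_{\nu\in\mathcal G'}D_F(\nu,\nu_1)\in[-\infty,+\infty]$, $$\sum_{t=1}^T\langle\nu_t,f_t\rangle-\inf_{\nu\in\mathcal G'}\sum_{t=1}^T\langle\nu,f_t\rangle\le\frac{D_F(\mathcal G')}{\rho}+2\rho T ,$$ as an inequality between extended real numbers. -/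

import Mathlib

noncomputable section

namespace OnlineMDP

section Polytope

variable {S A : Type*} [Fintype S]

/-- `K x u y` is the probability of moving from the state `x` to the state `y`
under the action `u`. -/
structure IsTransitionLaw (K : S → A → S → ℝ) : Prop where
  nonneg : ∀ x u y, 0 ≤ K x u y
  sum_eq_one : ∀ x u, ∑ y, K x u y = 1

/-- The state-action polytope of the MDP with transition law `K`: the set of all ergodic
occupation measures, as vectors in Euclidean space indexed by the state-action pairs. -/
def stateActionPolytope [Fintype A] (K : S → A → S → ℝ) : Set (EuclideanSpace ℝ (S × A)) :=
  {ν | (∀ p, 0 ≤ ν p) ∧ ∑ p, ν p = 1 ∧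
    ∀ y, ∑ p : S × A, K p.1 p.2 y * ν p = ∑ u, ν (y, u)}

end Polytope

section Barrier

variable {E : Type*} [NormedAddCommGroup E] [InnerProductSpace ℝ E] [FiniteDimensional ℝ E]

/-- `F` around the point `v`, as a function of a displacement `h` in the direction space of the
affine hull of `𝒢`. When `𝒢` has nonempty interior, the direction space is all of `E`. -/
def germ (𝒢 : Set E) (F : E → ℝ) (v : E) : vectorSpan ℝ 𝒢 → ℝ :=
  fun h => F (v + (h : E))

/-- The gradient `∇F(v)` of a function on the relative interior of `𝒢`: a vector in the direction
space of the affine hull of `𝒢`. -/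
def grad (𝒢 : Set E) (F : E → ℝ) (v : E) : E :=
  ((gradient (germ 𝒢 F v) 0 : vectorSpan ℝ 𝒢) : E)

/-- The Hessian quadratic form `∇²F(v)[h,h]`. -/
def hess (𝒢 : Set E) (F : E → ℝ) (v : E) (h : vectorSpan ℝ 𝒢) : ℝ :=
  iteratedFDeriv ℝ 2 (germ 𝒢 F v) 0 (fun _ => h)

/-- The cubic form `∇³F(v)[h,h,h]`. -/
def third (𝒢 : Set E) (F : E → ℝ) (v : E) (h : vectorSpan ℝ 𝒢) : ℝ :=
  iteratedFDeriv ℝ 3 (germ 𝒢 F v) 0 (fun _ => h)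

/-- The Bregman divergence `D_F(v,w) = F(v) - F(w) - ⟨∇F(w), v - w⟩`. -/
def bregman (𝒢 : Set E) (F : E → ℝ) (v w : E) : ℝ :=
  F v - F w - inner ℝ (grad 𝒢 F w) (v - w)

/-- The Legendre–Fenchel dual of `F`, the supremum being over the relative interior of `𝒢`.
It is a function on the whole space. -/
def dual (𝒢 : Set E) (F : E → ℝ) (h : E) : ℝ :=
  ⨆ v : intrinsicInterior ℝ 𝒢, (inner ℝ h (v : E) - F (v : E))

/-- The dual local norm of `f` at `h`, i.e. the square root of `∇²F*(h)[f,f]`. -/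
def dualLocalNorm (𝒢 : Set E) (F : E → ℝ) (h f : E) : ℝ :=
  Real.sqrt (iteratedFDeriv ℝ 2 (dual 𝒢 F) h (fun _ => f))

/-- `F` is a self-concordant barrier on (the relative interior of) `𝒢`. -/
structure IsSelfConcordantBarrier (𝒢 : Set E) (F : E → ℝ) : Prop where
  convex : ConvexOn ℝ (intrinsicInterior ℝ 𝒢) F
  contDiff : ∀ v ∈ intrinsicInterior ℝ 𝒢, ContDiffAt ℝ 3 (germ 𝒢 F v) 0
  selfConcordant : ∀ v ∈ intrinsicInterior ℝ 𝒢, ∀ h : vectorSpan ℝ 𝒢,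
    third 𝒢 F v h ≤ 2 * hess 𝒢 F v h ^ (3 / 2 : ℝ)
  barrier : ∀ x ∈ intrinsicFrontier ℝ 𝒢,
    Filter.Tendsto F (nhdsWithin x (intrinsicInterior ℝ 𝒢)) Filter.atTop

/-- A self-concordant barrier such that `F` and its dual are strictly convex, the gradient map is
a bijection with inverse `∇F*`, and the minimum value of `F` is `0`. -/
structure IsRegularBarrier (𝒢 : Set E) (F : E → ℝ) : Prop
    extends IsSelfConcordantBarrier 𝒢 F where
  strictConvex : StrictConvexOn ℝ (intrinsicInterior ℝ 𝒢) F
  strictConvex_dual : StrictConvexOn ℝ (vectorSpan ℝ 𝒢 : Set E) (dual 𝒢 F)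
  bijOn_grad : Set.BijOn (grad 𝒢 F) (intrinsicInterior ℝ 𝒢) (vectorSpan ℝ 𝒢 : Set E)
  grad_dual : ∀ v ∈ intrinsicInterior ℝ 𝒢, HasGradientAt (dual 𝒢 F) v (grad 𝒢 F v)
  min_eq_zero : IsLeast (F '' intrinsicInterior ℝ 𝒢) 0

/-- `ν 1, ν 2, …` is the mirror-descent sequence with learning rate `ρ` and costs `f 1, f 2, …`:
it starts at the minimizer of `F` and `ν (t+1) = ∇F*(∇F(ν t) - ρ f t)`. -/
structure IsMirrorDescent (𝒢 : Set E) (F : E → ℝ) (ρ : ℝ) (f ν : ℕ → E) : Prop where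
  mem : ν 1 ∈ intrinsicInterior ℝ 𝒢
  isMinOn : IsMinOn F (intrinsicInterior ℝ 𝒢) (ν 1)
  step : ∀ t, 1 ≤ t → ν (t + 1) = gradient (dual 𝒢 F) (grad 𝒢 F (ν t) - ρ • f t)

/-- `D_F(𝒢')`, the supremum over `ν ∈ 𝒢'` of `D_F(ν, ν₁)`, possibly infinite. -/
def bregmanSup (𝒢 : Set E) (F : E → ℝ) (𝒢' : Set E) (ν₁ : E) : EReal :=
  ⨆ ν ∈ 𝒢', ((bregman 𝒢 F ν ν₁ : ℝ) : EReal)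

end Barrier

end OnlineMDP

end

/-! Since `∇F*` inverts `∇F`, a mirror-descent step subtracts `ρ f_t`, projected onto `V`, from the
gradient. The three-point identity then writes `ρ⟨ν_t - μ, f_t⟩` as `D_F(μ,ν_t) - D_F(μ,ν_{t+1}) +
D_F(ν_t,ν_{t+1})`. The first two terms telescope, so it remains to bound the last by `2ρ²`.

Let `r` be the local norm of `ν_{t+1} - ν_t` at `ν_t`, and `l` be `ρ` times the dual local norm of
`f_t`. Self-concordance along the segment (`selfConcordant_lower_bound`) and Cauchy–Schwarz between
the two norms (`abs_inner_le_dualLocalNorm_mul`) give `D_F(ν_t,ν_{t+1}) ≤ log(1+r) - r + l r`. This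
is at most `2l²` when `l ≤ 1/2` (`log_one_add_sub_le`), and `l ≤ ρ`.

Cauchy–Schwarz needs `∇²F*` to be the inverse of `∇²F` on `V`, hence a nondegenerate Hessian;
`hess_pos` derives this from strict convexity and self-concordance. -/

namespace OnlineMDP

open Set Filter Topology

/-! ### One-variable inequalities for self-concordant functions. -/

section OneDim

/-- A nonnegative function with `|ψ'| ≤ 2 ψ ^ (3/2)` that vanishes at a point
vanishes to its right. -/
theorem eq_zero_of_abs_deriv_le_rpow {a b : ℝ} {ψ ψ' : ℝ → ℝ}
    (hψ : ∀ t ∈ Icc a b, HasDerivAt ψ (ψ' t) t) (hpos : ∀ t ∈ Icc a b, 0 ≤ ψ t)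
    (hsc : ∀ t ∈ Icc a b, |ψ' t| ≤ 2 * ψ t ^ (3 / 2 : ℝ)) (ha : ψ a = 0) :
    ∀ t ∈ Icc a b, ψ t = 0 := by
  have hc : ContinuousOn ψ (Icc a b) := fun t ht => (hψ t ht).continuousAt.continuousWithinAt
  obtain ⟨M, hM⟩ := isCompact_Icc.exists_bound_of_continuousOn hc
  -- With `ψ ≤ M` on the compact interval, `ψ ^ (3/2) ≤ M ^ (1/2) * ψ`, so the hypothesis becomes
  -- linear and Grönwall applies.
  refine eq_zero_of_abs_deriv_le_mul_abs_self_of_eq_zero_right (f' := ψ')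
    (K := 2 * M ^ (1 / 2 : ℝ)) hc
    (fun t ht => (hψ t (Ico_subset_Icc_self ht)).hasDerivWithinAt) ha ?_
  intro t ht
  have ht' := Ico_subset_Icc_self ht
  have h0 := hpos t ht'
  have hb : ψ t ≤ M := (Real.le_norm_self _).trans (hM t ht')
  rw [Real.norm_eq_abs, Real.norm_of_nonneg h0]
  refine (hsc t ht').trans ?_
  have h1 : ψ t ^ (3 / 2 : ℝ) = ψ t ^ (1 / 2 : ℝ) * ψ t := by
    rcases h0.eq_or_lt with h | h
    · rw [← h, Real.zero_rpow (by norm_num)]; simp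
    · rw [← Real.rpow_add_one h.ne']; norm_num
  rw [h1, mul_assoc]
  gcongr

/-- The lower bound of a self-concordant function along a segment. -/
theorem selfConcordant_lower_bound {φ φ' ψ ψ' : ℝ → ℝ}
    (h1 : ∀ t ∈ Icc (0 : ℝ) 1, HasDerivAt φ (φ' t) t)
    (h2 : ∀ t ∈ Icc (0 : ℝ) 1, HasDerivAt φ' (ψ t) t)
    (h3 : ∀ t ∈ Icc (0 : ℝ) 1, HasDerivAt ψ (ψ' t) t)
    (hpos : ∀ t ∈ Icc (0 : ℝ) 1, 0 < ψ t)
    (hsc : ∀ t ∈ Icc (0 : ℝ) 1, -ψ' t ≤ 2 * ψ t ^ (3 / 2 : ℝ)) :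
    φ 0 + φ' 0 + √(ψ 0) - Real.log (1 + √(ψ 0)) ≤ φ 1 := by
  set r := √(ψ 0) with hr
  have z0 : (0 : ℝ) ∈ Icc (0 : ℝ) 1 := by simp
  have rpos : 0 < r := Real.sqrt_pos.2 (hpos 0 z0)
  have mono : ∀ {f f' : ℝ → ℝ}, (∀ t ∈ Icc (0 : ℝ) 1, HasDerivAt f (f' t) t) →
      (∀ t ∈ Icc (0 : ℝ) 1, 0 ≤ f' t) → ∀ t ∈ Icc (0 : ℝ) 1, f 0 ≤ f t := by
    intro f f' hf hf' t ht
    refine monotoneOn_of_deriv_nonneg (convex_Icc 0 1)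
      (fun t ht => (hf t ht).continuousAt.continuousWithinAt)
      (fun t ht => (hf t (interior_subset ht)).differentiableAt.differentiableWithinAt)
      (fun t ht => ?_) z0 ht ht.1
    rw [(hf t (interior_subset ht)).deriv]
    exact hf' t (interior_subset ht)
  have hden : ∀ t ∈ Icc (0 : ℝ) 1, 0 < 1 + r * t := fun t ht => by
    have := mul_nonneg rpos.le ht.1
    linarith
  -- Self-concordance says that `ψ ^ (-1/2)` has derivative at most `1`. Integrating this bound,
  -- then `ψ`, then `φ'`, gives the three estimates below.
  have s1 : ∀ t ∈ Icc (0 : ℝ) 1, (r / (1 + r * t)) ^ 2 ≤ ψ t := by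
    intro t ht
    have key := mono (f := fun t => t - (√(ψ t))⁻¹)
      (f' := fun t => 1 - (-(ψ' t / (2 * √(ψ t))) / √(ψ t) ^ 2))
      (fun t ht => (hasDerivAt_id t).sub
        (((h3 t ht).sqrt (hpos t ht).ne').inv (Real.sqrt_pos.2 (hpos t ht)).ne'))
      (fun t ht => by
        have hp := hpos t ht
        have hs := Real.sqrt_pos.2 hp
        have e : ψ t ^ (3 / 2 : ℝ) = √(ψ t) ^ 3 := by
          rw [Real.sqrt_eq_rpow, ← Real.rpow_natCast, ← Real.rpow_mul hp.le]
          norm_num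
        have := hsc t ht
        rw [e] at this
        have e2 : -(ψ' t / (2 * √(ψ t))) / √(ψ t) ^ 2 = -ψ' t / (2 * √(ψ t) ^ 3) := by
          field_simp
        rw [e2, sub_nonneg, div_le_one (by positivity)]
        exact this) t ht
    have hs := Real.sqrt_pos.2 (hpos t ht)
    have hd := hden t ht
    simp only [← hr] at key
    have h4 : (√(ψ t))⁻¹ ≤ (1 + r * t) / r := by
      have : (1 + r * t) / r = r⁻¹ + t := by field_simp
      linarith
    have h5 : r / (1 + r * t) ≤ √(ψ t) := by
      rw [← inv_div]
      exact inv_le_of_inv_le₀ hs h4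
    calc _ ≤ √(ψ t) ^ 2 := by gcongr
      _ = _ := Real.sq_sqrt (hpos t ht).le
  have hlin : ∀ t : ℝ, HasDerivAt (fun t => 1 + r * t) r t := fun t => by
    simpa using ((hasDerivAt_id t).const_mul r).const_add 1
  have s2 : ∀ t ∈ Icc (0 : ℝ) 1, φ' 0 + r - r / (1 + r * t) ≤ φ' t := by
    intro t ht
    have key := mono (f := fun t => φ' t + r * (1 + r * t)⁻¹)
      (f' := fun t => ψ t + r * (-r / (1 + r * t) ^ 2))
      (fun t ht => (h2 t ht).add (((hlin t).inv (hden t ht).ne').const_mul r))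
      (fun t ht => by
        have := s1 t ht
        rw [div_pow] at this
        have e : r * (-r / (1 + r * t) ^ 2) = - (r ^ 2 / (1 + r * t) ^ 2) := by ring
        rw [e]; linarith) t ht
    simp only [mul_zero, add_zero, inv_one, mul_one] at key
    rw [div_eq_mul_inv]; linarith
  have key := mono (f := fun t => φ t - (φ' 0 + r) * t + Real.log (1 + r * t))
    (f' := fun t => φ' t - (φ' 0 + r) * 1 + r / (1 + r * t))
    (fun t ht => ((h1 t ht).sub ((hasDerivAt_id t).const_mul _)).add
      ((hlin t).log (hden t ht).ne'))
    (fun t ht => by have := s2 t ht; linarith) 1 (by simp)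
  simp only [mul_zero, add_zero, Real.log_one, mul_one, sub_zero] at key
  linarith

/-- For `l < 1` the maximum of the left side over `r` is `-l - log (1 - l)`, the convex conjugate of
`r - log (1 + r)`. Both logarithms are estimated by `log x ≤ x - 1`; `l ≤ 1/2` makes the remainder
`l² (1 - 2l)` nonnegative. -/
theorem log_one_add_sub_le {l r : ℝ} (hl : l ≤ 1 / 2) (hr : 0 ≤ r) :
    Real.log (1 + r) - r + l * r ≤ 2 * l ^ 2 := by
  have h1 : Real.log ((1 + r) * (1 - l)) ≤ (1 + r) * (1 - l) - 1 :=
    Real.log_le_sub_one_of_pos (mul_pos (by linarith) (by linarith))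
  have h2 : Real.log (1 - l)⁻¹ ≤ (1 - l)⁻¹ - 1 :=
    Real.log_le_sub_one_of_pos (inv_pos.2 (by linarith))
  rw [Real.log_mul (by linarith) (by linarith)] at h1
  rw [Real.log_inv] at h2
  have h3 : (1 - l)⁻¹ ≤ 1 + l + 2 * l ^ 2 := by
    rw [inv_le_iff_one_le_mul₀ (by linarith)]
    nlinarith [mul_nonneg (sq_nonneg l) (by linarith : 0 ≤ 1 - 2 * l)]
  linarith

end OneDim

/-! ### Calculus along the direction space, and positivity of the Hessian. -/

section Germ

variable {E : Type*} [NormedAddCommGroup E] [InnerProductSpace ℝ E]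
  {𝒢 : Set E} {F : E → ℝ} {v w : E}

theorem sub_mem_vectorSpan_of_mem_intrinsicInterior (hv : v ∈ intrinsicInterior ℝ 𝒢)
    (hw : w ∈ intrinsicInterior ℝ 𝒢) : v - w ∈ vectorSpan ℝ 𝒢 :=
  vsub_mem_vectorSpan ℝ (intrinsicInterior_subset hv) (intrinsicInterior_subset hw)

theorem eventually_add_mem_intrinsicInterior (hv : v ∈ intrinsicInterior ℝ 𝒢) :
    ∀ᶠ x : vectorSpan ℝ 𝒢 in 𝓝 0, v + (x : E) ∈ intrinsicInterior ℝ 𝒢 := by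
  obtain ⟨p, hp, rfl⟩ := hv
  have hmem : ∀ x : vectorSpan ℝ 𝒢, (p : E) + (x : E) ∈ affineSpan ℝ 𝒢 := fun x => by
    have := AffineSubspace.vadd_mem_of_mem_direction
      (by rw [direction_affineSpan]; exact x.2) p.2
    rwa [vadd_eq_add, add_comm] at this
  have hcont : Continuous fun x : vectorSpan ℝ 𝒢 =>
      (⟨(p : E) + (x : E), hmem x⟩ : affineSpan ℝ 𝒢) := by
    fun_prop
  have h0 : (⟨(p : E) + ((0 : vectorSpan ℝ 𝒢) : E), hmem 0⟩ : affineSpan ℝ 𝒢) = p := by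
    ext; simp
  have := hcont.continuousAt.eventually_mem
    (x := 0) (s := interior ((↑) ⁻¹' 𝒢 : Set (affineSpan ℝ 𝒢)))
    (by rw [h0]; exact isOpen_interior.mem_nhds hp)
  filter_upwards [this] with x hx
  exact ⟨_, hx, rfl⟩

/-- Moving the base point is a translation, so derivatives at `0` of varying germs become
derivatives of one fixed germ at varying points. -/
theorem germ_add (x : vectorSpan ℝ 𝒢) :
    germ 𝒢 F (v + x) = fun y => germ 𝒢 F v (x + y) := by
  ext y
  simp [germ, add_assoc]

theorem hess_add (x h : vectorSpan ℝ 𝒢) :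
    hess 𝒢 F (v + x) h = iteratedFDeriv ℝ 2 (germ 𝒢 F v) x (fun _ => h) := by
  rw [hess, germ_add, iteratedFDeriv_comp_add_left, add_zero]

theorem third_add (x h : vectorSpan ℝ 𝒢) :
    third 𝒢 F (v + x) h = iteratedFDeriv ℝ 3 (germ 𝒢 F v) x (fun _ => h) := by
  rw [third, germ_add, iteratedFDeriv_comp_add_left, add_zero]

/-- Successive directional derivatives along a line. -/
theorem hasDerivAt_iteratedFDeriv_smul {V W : Type*} [NormedAddCommGroup V] [NormedSpace ℝ V]
    [NormedAddCommGroup W] [NormedSpace ℝ W] {g : V → W} {n : ℕ} {h : V} {t : ℝ}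
    (hg : ContDiffAt ℝ (n + 1 : ℕ) g (t • h)) :
    HasDerivAt (fun s : ℝ => iteratedFDeriv ℝ n g (s • h) (fun _ => h))
      (iteratedFDeriv ℝ (n + 1) g (t • h) (fun _ => h)) t := by
  have h1 := (hg.differentiableAt_iteratedFDeriv (m := n)
    (by exact_mod_cast n.lt_succ_self)).hasFDerivAt
  have h2 : HasDerivAt (fun s : ℝ => s • h) h t := by
    simpa using (hasDerivAt_id t).smul_const h
  have h3 := h1.comp_hasDerivAt t h2
  have h4 := ((ContinuousMultilinearMap.apply ℝ (fun _ : Fin n => V) W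
    (fun _ => h)).hasFDerivAt).comp_hasDerivAt t h3
  rw [iteratedFDeriv_succ_apply_left]
  exact h4

namespace IsSelfConcordantBarrier

theorem contDiffAt_germ (hF : IsSelfConcordantBarrier 𝒢 F)
    {x : vectorSpan ℝ 𝒢} (hx : v + (x : E) ∈ intrinsicInterior ℝ 𝒢) :
    ContDiffAt ℝ 3 (germ 𝒢 F v) x := by
  have h := hF.contDiff _ hx
  have e : germ 𝒢 F v = fun y => germ 𝒢 F (v + x) (y - x) := by
    ext y
    simp [germ]
  rw [e]
  exact ContDiffAt.comp (g := germ 𝒢 F (v + x)) x (by rwa [sub_self]) (contDiffAt_id.sub contDiffAt_const)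

/-- The cubic form is odd in `h` and the Hessian form is even, so the one-sided bound at `-h` gives
the other side. -/
theorem abs_third_le (hF : IsSelfConcordantBarrier 𝒢 F)
    (hv : v ∈ intrinsicInterior ℝ 𝒢) (h : vectorSpan ℝ 𝒢) :
    |third 𝒢 F v h| ≤ 2 * hess 𝒢 F v h ^ (3 / 2 : ℝ) := by
  have h1 := hF.selfConcordant v hv h
  have h2 := hF.selfConcordant v hv (-h)
  have e : ∀ n : ℕ, iteratedFDeriv ℝ n (germ 𝒢 F v) 0 (fun _ => -h)
      = (-1) ^ n * iteratedFDeriv ℝ n (germ 𝒢 F v) 0 (fun _ => h) := fun n => by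
    have := (iteratedFDeriv ℝ n (germ 𝒢 F v) 0).map_smul_univ (fun _ => (-1 : ℝ)) (fun _ => h)
    simpa using this
  have e2 : hess 𝒢 F v (-h) = hess 𝒢 F v h := by simp [hess, e]
  have e3 : third 𝒢 F v (-h) = -third 𝒢 F v h := by rw [third, e, third]; norm_num
  rw [e2, e3] at h2
  exact abs_le.2 ⟨by linarith, h1⟩

theorem hasDerivAt_hess_line (hF : IsSelfConcordantBarrier 𝒢 F)
    {h : vectorSpan ℝ 𝒢} {t : ℝ}
    (ht : v + t • (h : E) ∈ intrinsicInterior ℝ 𝒢) :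
    HasDerivAt (fun s : ℝ => hess 𝒢 F (v + s • (h : E)) h)
      (third 𝒢 F (v + t • (h : E)) h) t := by
  have hg := hF.contDiffAt_germ (x := t • h) ht
  have := hasDerivAt_iteratedFDeriv_smul (n := 2) (hg.of_le (by norm_num))
  simp only [← hess_add] at this
  rw [two_add_one_eq_three, ← third_add] at this
  exact this

end IsSelfConcordantBarrier

variable [FiniteDimensional ℝ E]

theorem grad_mem : grad 𝒢 F v ∈ vectorSpan ℝ 𝒢 := Subtype.coe_prop _

theorem inner_grad_add (x h : vectorSpan ℝ 𝒢) :
    inner ℝ (grad 𝒢 F (v + x)) (h : E) = iteratedFDeriv ℝ 1 (germ 𝒢 F v) x (fun _ => h) := by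
  rw [grad, ← Submodule.coe_inner, ← InnerProductSpace.toDual_apply_apply, toDual_gradient,
    iteratedFDeriv_one_apply, germ_add, fderiv_comp_add_left, add_zero]

theorem grad_add (x : vectorSpan ℝ 𝒢) :
    grad 𝒢 F (v + x) = ((gradient (germ 𝒢 F v) x : vectorSpan ℝ 𝒢) : E) := by
  rw [grad, gradient, gradient, germ_add, fderiv_comp_add_left, add_zero]

namespace IsSelfConcordantBarrier

theorem hasDerivAt_line (hF : IsSelfConcordantBarrier 𝒢 F)
    {h : vectorSpan ℝ 𝒢} {t : ℝ}
    (ht : v + t • (h : E) ∈ intrinsicInterior ℝ 𝒢) :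
    HasDerivAt (fun s : ℝ => F (v + s • (h : E)))
      (inner ℝ (grad 𝒢 F (v + t • (h : E))) (h : E)) t := by
  have hg := hF.contDiffAt_germ (x := t • h) ht
  have := hasDerivAt_iteratedFDeriv_smul (n := 0) (hg.of_le (by norm_num))
  rw [zero_add, ← inner_grad_add] at this
  simpa [germ] using this

theorem hasDerivAt_inner_grad_line (hF : IsSelfConcordantBarrier 𝒢 F)
    {h : vectorSpan ℝ 𝒢} {t : ℝ}
    (ht : v + t • (h : E) ∈ intrinsicInterior ℝ 𝒢) :
    HasDerivAt (fun s : ℝ => inner ℝ (grad 𝒢 F (v + s • (h : E))) (h : E))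
      (hess 𝒢 F (v + t • (h : E)) h) t := by
  have hg := hF.contDiffAt_germ (x := t • h) ht
  have := hasDerivAt_iteratedFDeriv_smul (n := 1) (hg.of_le (by norm_num))
  simp only [← inner_grad_add] at this
  rw [one_add_one_eq_two, ← hess_add] at this
  exact this

/-- The first-order convexity inequality. -/
theorem bregman_nonneg (hF : IsSelfConcordantBarrier 𝒢 F)
    (hv : v ∈ intrinsicInterior ℝ 𝒢) (hw : w ∈ intrinsicInterior ℝ 𝒢) :
    0 ≤ bregman 𝒢 F v w := by
  let h : vectorSpan ℝ 𝒢 := ⟨v - w, sub_mem_vectorSpan_of_mem_intrinsicInterior hv hw⟩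
  have hd := hF.hasDerivAt_line (v := w) (h := h) (t := 0) (by simpa using hw)
  have hseg : ∀ t ∈ Icc (0 : ℝ) 1, w + t • (v - w) ∈ intrinsicInterior ℝ 𝒢 := fun t ht =>
    hF.convex.1.add_smul_sub_mem hw hv ht
  have hc : ConvexOn ℝ (Icc (0 : ℝ) 1) fun s : ℝ => F (w + s • (v - w)) := by
    have := (hF.convex.comp_affineMap (AffineMap.lineMap w v)).subset (s := Icc (0 : ℝ) 1)
      (fun t ht => by
        rw [mem_preimage, AffineMap.lineMap_apply, vsub_eq_sub, vadd_eq_add, add_comm]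
        exact hseg t ht) (convex_Icc 0 1)
    refine this.congr fun s _ => ?_
    simp [AffineMap.lineMap_apply, add_comm]
  have := hc.le_slope_of_hasDerivAt (x := 0) (y := 1) (by simp) (by simp) one_pos hd
  simp [slope_def_field, h] at this
  rw [bregman]
  linarith

/-- Adding the Bregman inequalities in both directions shows that the gradient is monotone; the
Hessian is a limit of its difference quotients. -/
theorem hess_nonneg (hF : IsSelfConcordantBarrier 𝒢 F)
    (hv : v ∈ intrinsicInterior ℝ 𝒢) (h : vectorSpan ℝ 𝒢) :
    0 ≤ hess 𝒢 F v h := by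
  have hd := hF.hasDerivAt_inner_grad_line (v := v) (h := h) (t := 0) (by simpa using hv)
  rw [zero_smul, add_zero] at hd
  have hev : ∀ᶠ t : ℝ in 𝓝 0, v + t • (h : E) ∈ intrinsicInterior ℝ 𝒢 := by
    have hc : Tendsto (fun t : ℝ => t • h) (𝓝 0) (𝓝 0) := by
      have : Continuous fun t : ℝ => t • h := by fun_prop
      simpa using this.tendsto 0
    exact hc.eventually (eventually_add_mem_intrinsicInterior hv)
  refine ge_of_tendsto hd.tendsto_slope ?_
  filter_upwards [hev.filter_mono nhdsWithin_le_nhds, self_mem_nhdsWithin] with t ht ht0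
  have h1 := hF.bregman_nonneg hv ht
  have h2 := hF.bregman_nonneg ht hv
  simp only [bregman, inner_smul_right, sub_add_cancel_left, add_sub_cancel_left,
    inner_neg_right] at h1 h2
  rw [slope_def_field]
  simp only [zero_smul, add_zero, sub_zero]
  -- Multiplying through by `t` makes the denominator `t * t`, which covers both signs of `t`.
  rw [← mul_div_mul_left _ _ (show t ≠ 0 from ht0)]
  exact div_nonneg (by linarith) (mul_self_nonneg t)

/-- A strictly convex self-concordant function has nondegenerate Hessian. -/
theorem hess_pos (hF : IsSelfConcordantBarrier 𝒢 F)
    (hconv : StrictConvexOn ℝ (intrinsicInterior ℝ 𝒢) F)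
    (hv : v ∈ intrinsicInterior ℝ 𝒢) {h : vectorSpan ℝ 𝒢} (hh : h ≠ 0) :
    0 < hess 𝒢 F v h := by
  refine (hF.hess_nonneg hv h).lt_of_ne' fun h0 => ?_
  have hev : ∀ᶠ t : ℝ in 𝓝 0, v + t • (h : E) ∈ intrinsicInterior ℝ 𝒢 := by
    have hc : Tendsto (fun t : ℝ => t • h) (𝓝 0) (𝓝 0) := by
      have : Continuous fun t : ℝ => t • h := by fun_prop
      simpa using this.tendsto 0
    exact hc.eventually (eventually_add_mem_intrinsicInterior hv)
  obtain ⟨ε, hε, hball⟩ := Metric.eventually_nhds_iff.1 hev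
  set b := ε / 2 with hb
  have hb0 : 0 < b := by positivity
  have hmem : ∀ t ∈ Icc 0 b, v + t • (h : E) ∈ intrinsicInterior ℝ 𝒢 := fun t ht =>
    hball (by rw [Real.dist_0_eq_abs, abs_of_nonneg ht.1]; linarith [ht.2])
  -- A Hessian vanishing at `v` along `h` vanishes on a whole segment, where `F` is then affine; the
  -- midpoint contradicts strict convexity.
  have hz := eq_zero_of_abs_deriv_le_rpow (a := 0) (b := b)
    (fun t ht => hF.hasDerivAt_hess_line (hmem t ht)) (fun t ht => hF.hess_nonneg (hmem t ht) h)
    (fun t ht => hF.abs_third_le (hmem t ht) h) (by simpa using h0)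
  have hconst : ∀ t ∈ Icc 0 b, inner ℝ (grad 𝒢 F (v + t • (h : E))) (h : E)
      = inner ℝ (grad 𝒢 F v) (h : E) := by
    intro t ht
    have := constant_of_has_deriv_right_zero
      (f := fun s : ℝ => inner ℝ (grad 𝒢 F (v + s • (h : E))) (h : E)) (a := 0) (b := b)
      (fun t ht => (hF.hasDerivAt_inner_grad_line (hmem t ht)).continuousAt.continuousWithinAt)
      (fun t ht => by
        have h1 := hF.hasDerivAt_inner_grad_line (hmem t (Ico_subset_Icc_self ht))
        rw [hz t (Ico_subset_Icc_self ht)] at h1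
        exact h1.hasDerivWithinAt) t ht
    simpa using this
  have hlin : ∀ t ∈ Icc 0 b, F (v + t • (h : E)) - t * inner ℝ (grad 𝒢 F v) (h : E) = F v := by
    intro t ht
    have hd : ∀ t ∈ Icc 0 b, HasDerivAt
        (fun s : ℝ => F (v + s • (h : E)) - s * inner ℝ (grad 𝒢 F v) (h : E)) 0 t := by
      intro t ht
      have h1 := (hF.hasDerivAt_line (hmem t ht)).sub
        ((hasDerivAt_id t).mul_const (inner ℝ (grad 𝒢 F v) (h : E)))
      rw [hconst t ht, one_mul, sub_self] at h1
      exact h1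
    have := constant_of_has_deriv_right_zero
      (fun t ht => (hd t ht).continuousAt.continuousWithinAt)
      (fun t ht => (hd t (Ico_subset_Icc_self ht)).hasDerivWithinAt) t ht
    simpa using this
  have hne : v ≠ v + b • (h : E) := by
    simp [hb0.ne', hh]
  have hb_mem : b ∈ Icc 0 b := ⟨hb0.le, le_rfl⟩
  have hb2_mem : b / 2 ∈ Icc 0 b := ⟨by positivity, by linarith⟩
  have hs := hconv.2 hv (hmem b hb_mem) hne (show (0 : ℝ) < 1 / 2 by norm_num)
    (show (0 : ℝ) < 1 / 2 by norm_num) (by norm_num)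
  have e : (1 / 2 : ℝ) • v + (1 / 2 : ℝ) • (v + b • (h : E)) = v + (b / 2) • (h : E) := by
    module
  rw [e] at hs
  have h1 := hlin _ hb_mem
  have h2 := hlin _ hb2_mem
  simp only [smul_eq_mul] at hs
  linarith

end IsSelfConcordantBarrier

end Germ

/-! ### The dual function, its derivatives, and the one-step Bregman bound. -/

section Dual

variable {E : Type*} [NormedAddCommGroup E] [InnerProductSpace ℝ E] [FiniteDimensional ℝ E]
  {𝒢 : Set E} {F : E → ℝ} {v w y : E}

/-- The supremum defining the dual at `y` is attained where the gradient is the projection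
of `y`. -/
theorem IsSelfConcordantBarrier.dual_eq (hF : IsSelfConcordantBarrier 𝒢 F)
    (hv : v ∈ intrinsicInterior ℝ 𝒢)
    (hy : grad 𝒢 F v = (vectorSpan ℝ 𝒢).starProjection y) :
    dual 𝒢 F y = inner ℝ y v - F v := by
  have hle : ∀ w : intrinsicInterior ℝ 𝒢, inner ℝ y (w : E) - F w ≤ inner ℝ y v - F v := by
    intro w
    have h1 := hF.bregman_nonneg w.2 hv
    have h2 : inner ℝ (grad 𝒢 F v) ((w : E) - v) = inner ℝ y ((w : E) - v) := by
      rw [hy, Submodule.inner_starProjection_left_eq_right,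
        Submodule.starProjection_eq_self_iff.2
          (sub_mem_vectorSpan_of_mem_intrinsicInterior w.2 hv)]
    rw [bregman, h2, inner_sub_right] at h1
    linarith
  have : Nonempty (intrinsicInterior ℝ 𝒢) := ⟨⟨v, hv⟩⟩
  exact le_antisymm (ciSup_le hle) (le_ciSup (f := fun w : intrinsicInterior ℝ 𝒢 =>
    inner ℝ y (w : E) - F w) ⟨_, forall_mem_range.2 hle⟩ ⟨v, hv⟩)

namespace IsRegularBarrier

theorem exists_grad_eq (hF : IsRegularBarrier 𝒢 F) (y : E) :
    ∃ w ∈ intrinsicInterior ℝ 𝒢, grad 𝒢 F w = (vectorSpan ℝ 𝒢).starProjection y :=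
  hF.bijOn_grad.surjOn (Submodule.starProjection_apply_mem _ y)

/-- The dual off the direction space of the affine hull. -/
theorem dual_eq_add (hF : IsRegularBarrier 𝒢 F) (hv : v ∈ intrinsicInterior ℝ 𝒢) (y : E) :
    dual 𝒢 F y = dual 𝒢 F ((vectorSpan ℝ 𝒢).starProjection y)
      + inner ℝ (y - (vectorSpan ℝ 𝒢).starProjection y) v := by
  obtain ⟨w, hw, h⟩ := hF.exists_grad_eq y
  rw [hF.dual_eq hw h, hF.dual_eq hw (y := (vectorSpan ℝ 𝒢).starProjection y) (by
    rw [h, Submodule.starProjection_eq_self_iff.2 (Submodule.starProjection_apply_mem _ y)])]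
  -- The part of `y` orthogonal to the direction space pairs equally with all points of the relative
  -- interior, so `w` may be replaced by `v`.
  have := Submodule.sub_starProjection_mem_orthogonal (K := vectorSpan ℝ 𝒢) y
  have h0 := Submodule.inner_left_of_mem_orthogonal
    (sub_mem_vectorSpan_of_mem_intrinsicInterior hw hv) this
  rw [inner_sub_right, sub_eq_zero] at h0
  rw [← h0, inner_sub_left]
  ring

/-- Off the direction space the dual splits as `F*(P y) + ⟨y - P y, w⟩`; the two gradients `P w` and
`w - P w` add up to `w`. -/
theorem hasGradientAt_dual (hF : IsRegularBarrier 𝒢 F) (hw : w ∈ intrinsicInterior ℝ 𝒢)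
    (hy : grad 𝒢 F w = (vectorSpan ℝ 𝒢).starProjection y) :
    HasGradientAt (dual 𝒢 F) w y := by
  set P := (vectorSpan ℝ 𝒢).starProjection with hP
  have h1 := (hF.grad_dual w hw).hasFDerivAt
  rw [hy] at h1
  have h2 : HasFDerivAt (fun y => dual 𝒢 F (P y)) _ y := h1.comp y P.hasFDerivAt
  have h3 : HasFDerivAt (fun y => inner ℝ w (y - P y))
      ((innerSL ℝ w).comp (ContinuousLinearMap.id ℝ E - P)) y :=
    ((innerSL ℝ w).comp (ContinuousLinearMap.id ℝ E - P)).hasFDerivAt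
  have h4 := h2.add h3
  rw [hasGradientAt_iff_hasFDerivAt]
  refine (h4.congr_of_eventuallyEq (Eventually.of_forall fun y => ?_)).congr_fderiv ?_
  · rw [hF.dual_eq_add hw y, real_inner_comm]
    rfl
  · ext z
    simp

theorem grad_gradient_dual (hF : IsRegularBarrier 𝒢 F) (y : E) :
    gradient (dual 𝒢 F) y ∈ intrinsicInterior ℝ 𝒢 ∧
      grad 𝒢 F (gradient (dual 𝒢 F) y) = (vectorSpan ℝ 𝒢).starProjection y := by
  obtain ⟨w, hw, h⟩ := hF.exists_grad_eq y
  rw [(hF.hasGradientAt_dual hw h).gradient]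
  exact ⟨hw, h⟩

/-- The Cauchy–Schwarz inequality for the local norm of `F` and the dual local norm. The Hessian
of the dual exists, and is inverse to that of `F`, by the inverse function theorem. -/
theorem abs_inner_le_dualLocalNorm_mul (hF : IsRegularBarrier 𝒢 F)
    (hv : v ∈ intrinsicInterior ℝ 𝒢) (f : E) (u : vectorSpan ℝ 𝒢) :
    |inner ℝ f (u : E)| ≤ dualLocalNorm 𝒢 F (grad 𝒢 F v) f * √(hess 𝒢 F v u) := by
  let V := vectorSpan ℝ 𝒢
  set g := germ 𝒢 F v with hg
  have hC : ContDiffAt ℝ 3 g 0 := hF.contDiff v hv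
  have hC' : ContDiffAt ℝ 2 (fderiv ℝ g) 0 := hC.fderiv_right (by norm_num)
  let D := (InnerProductSpace.toDual ℝ V).symm.toContinuousLinearEquiv.toContinuousLinearMap
  let H : V →L[ℝ] V := D.comp (fderiv ℝ (fderiv ℝ g) 0)
  have hA : HasStrictFDerivAt (gradient g) H 0 :=
    D.hasStrictFDerivAt.comp 0 (hC'.hasStrictFDerivAt (by norm_num))
  have hH : ∀ a b : V, inner ℝ (H a) b = fderiv ℝ (fderiv ℝ g) 0 a b := fun a b =>
    InnerProductSpace.toDual_symm_apply
  have hhess : ∀ a : V, hess 𝒢 F v a = inner ℝ (H a) a := fun a => by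
    rw [hH, hess, iteratedFDeriv_two_apply]
  have hsymm : ∀ a b : V, inner ℝ (H a) b = inner ℝ (H b) a := fun a b => by
    rw [hH, hH]
    exact (hC.isSymmSndFDerivAt (by simp; norm_num)) a b
  have hinj : Function.Injective (H : V →ₗ[ℝ] V) := by
    rw [← LinearMap.ker_eq_bot, LinearMap.ker_eq_bot']
    intro a ha
    by_contra hne
    have := hF.hess_pos hF.strictConvex hv hne
    rw [hhess, show H a = 0 from ha, inner_zero_left] at this
    exact this.false
  let He : V ≃L[ℝ] V := (LinearEquiv.ofInjectiveEndo (H : V →ₗ[ℝ] V) hinj).toContinuousLinearEquiv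
  have hHe : (He : V →L[ℝ] V) = H := by ext; rfl
  rw [← hHe] at hA
  let Q := V.orthogonalProjectionOnto
  set y₀ := grad 𝒢 F v with hy₀
  have hQy₀ : Q y₀ = gradient g 0 := by
    simp [Q, hy₀, grad, hg]
  let G := hA.localInverse
  have hG : HasFDerivAt G (He.symm : V →L[ℝ] V) (gradient g 0) := hA.to_localInverse.hasFDerivAt
  have hG0 : G (gradient g 0) = 0 := hA.localInverse_apply_image
  have hmem : ∀ᶠ z in 𝓝 (gradient g 0), v + (G z : E) ∈ intrinsicInterior ℝ 𝒢 := by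
    have : Tendsto G (𝓝 (gradient g 0)) (𝓝 0) := by
      simpa [hG0] using hG.continuousAt.tendsto
    exact this.eventually (eventually_add_mem_intrinsicInterior hv)
  have hQ : Tendsto Q (𝓝 y₀) (𝓝 (gradient g 0)) := by
    rw [← hQy₀]
    exact Q.continuous.continuousAt
  -- Near `y₀` the gradient of the dual is `v + G (Q y)`, with `G` the local inverse of the gradient
  -- of the germ. Its derivative is therefore `H⁻¹ Q`.
  have hfd : fderiv ℝ (dual 𝒢 F) =ᶠ[𝓝 y₀]
      fun y => InnerProductSpace.toDual ℝ E (v + (G (Q y) : E)) := by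
    filter_upwards [hQ.eventually hmem, hQ.eventually hA.eventually_right_inverse] with y h1 h2
    refine (hF.hasGradientAt_dual h1 ?_).hasFDerivAt.fderiv
    rw [grad_add, h2]
    rfl
  have hfd2 : HasFDerivAt (fun y => InnerProductSpace.toDual ℝ E (v + (G (Q y) : E)))
      ((InnerProductSpace.toDual ℝ E).toContinuousLinearEquiv.toContinuousLinearMap.comp
        (V.subtypeL.comp ((He.symm : V →L[ℝ] V).comp Q))) y₀ := by
    refine ((InnerProductSpace.toDual ℝ
      E).toContinuousLinearEquiv.toContinuousLinearMap.hasFDerivAt).comp y₀ (HasFDerivAt.const_add v ?_)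
    refine V.subtypeL.hasFDerivAt.comp y₀ (HasFDerivAt.comp y₀ ?_ Q.hasFDerivAt)
    rw [hQy₀]
    exact hG
  -- With `d = H⁻¹ Q f`, both `⟨f, u⟩ = ⟨H d, u⟩` and `∇²F*(y₀)[f,f] = ⟨H d, d⟩`, so the claim is
  -- Cauchy–Schwarz for the form of `H`.
  set d : V := He.symm (Q f) with hd
  have hHd : H d = Q f := by
    rw [← hHe]
    exact He.apply_symm_apply _
  have hfu : ∀ a : V, inner ℝ f (a : E) = inner ℝ (H d) a := fun a => by
    rw [hHd]
    exact (Submodule.inner_orthogonalProjectionOnto_eq_of_mem_right a f).symm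
  have hnorm : iteratedFDeriv ℝ 2 (dual 𝒢 F) y₀ (fun _ => f) = inner ℝ (H d) d := by
    rw [iteratedFDeriv_two_apply, hfd.fderiv_eq, hfd2.fderiv, ← hfu d, real_inner_comm]
    rfl
  have hpos : ∀ a : V, 0 ≤ inner ℝ (H a) a := fun a => hhess a ▸ hF.hess_nonneg hv a
  rw [dualLocalNorm, hnorm, hhess, hfu, ← Real.sqrt_mul (hpos d)]
  refine Real.abs_le_sqrt ?_
  have hquad : ∀ t : ℝ,
      0 ≤ inner ℝ (H d) d * (t * t) + (2 * inner ℝ (H d) u) * t + inner ℝ (H u) u := by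
    intro t
    have := hpos (t • d + u)
    simp only [map_add, map_smul, inner_add_left, inner_add_right, real_inner_smul_left,
      real_inner_smul_right, hsymm u d] at this
    linarith
  have := discrim_le_zero hquad
  rw [discrim] at this
  linarith

/-- The Bregman divergence between two consecutive points of mirror descent. -/
theorem bregman_le (hF : IsRegularBarrier 𝒢 F) (hv : v ∈ intrinsicInterior ℝ 𝒢)
    (hw : w ∈ intrinsicInterior ℝ 𝒢) {ρ : ℝ} (hρ : 0 ≤ ρ) {f : E}
    (hstep : grad 𝒢 F w = grad 𝒢 F v - ρ • (vectorSpan ℝ 𝒢).starProjection f)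
    (hf : ρ * dualLocalNorm 𝒢 F (grad 𝒢 F v) f ≤ 1 / 2) :
    bregman 𝒢 F v w ≤ 2 * (ρ * dualLocalNorm 𝒢 F (grad 𝒢 F v) f) ^ 2 := by
  set l := ρ * dualLocalNorm 𝒢 F (grad 𝒢 F v) f with hl
  let u : vectorSpan ℝ 𝒢 := ⟨w - v, sub_mem_vectorSpan_of_mem_intrinsicInterior hw hv⟩
  have hwu : w = v + (u : E) := by simp [u]
  -- The segment bound needs a strictly positive Hessian in direction `u`, so a vanishing step is
  -- treated apart.
  by_cases hu : u = 0
  · have : w = v := by rw [hwu, hu]; simp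
    rw [this, bregman]
    simp only [sub_self, inner_zero_right]
    positivity
  have hseg : ∀ t ∈ Icc (0 : ℝ) 1, v + t • (u : E) ∈ intrinsicInterior ℝ 𝒢 := fun t ht =>
    hF.convex.1.add_smul_sub_mem hv hw ht
  have key := selfConcordant_lower_bound
    (fun t ht => hF.hasDerivAt_line (hseg t ht))
    (fun t ht => hF.hasDerivAt_inner_grad_line (hseg t ht))
    (fun t ht => hF.hasDerivAt_hess_line (hseg t ht))
    (fun t ht => hF.hess_pos hF.strictConvex (hseg t ht) hu)
    (fun t ht => (neg_le_abs _).trans (hF.abs_third_le (hseg t ht) u))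
  simp only [zero_smul, add_zero, one_smul, ← hwu] at key
  set r := √(hess 𝒢 F v u)
  have hcs : ρ * -inner ℝ f (u : E) ≤ l * r := by
    rw [hl, mul_assoc]
    exact mul_le_mul_of_nonneg_left ((neg_le_abs _).trans (hF.abs_inner_le_dualLocalNorm_mul hv f u)) hρ
  have hin : inner ℝ (grad 𝒢 F w) (v - w) = -(inner ℝ (grad 𝒢 F v) (u : E))
      + ρ * inner ℝ f (u : E) := by
    have e : v - w = -(u : E) := by simp [u]
    rw [e, hstep, inner_neg_right, inner_sub_left, real_inner_smul_left,
      Submodule.inner_starProjection_left_eq_right, Submodule.starProjection_eq_self_iff.2 u.2]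
    ring
  have := log_one_add_sub_le hf (Real.sqrt_nonneg (hess 𝒢 F v u))
  rw [bregman, hin]
  linarith

end IsRegularBarrier

end Dual

/-! ### Telescoping the mirror-descent steps. -/

section Regret

variable {E : Type*} [NormedAddCommGroup E] [InnerProductSpace ℝ E] [FiniteDimensional ℝ E]
  {𝒢 : Set E} {F : E → ℝ} {ρ : ℝ} {f ν : ℕ → E}

namespace IsMirrorDescent

theorem mem_intrinsicInterior (hν : IsMirrorDescent 𝒢 F ρ f ν) (hF : IsRegularBarrier 𝒢 F)
    {t : ℕ} (ht : 1 ≤ t) : ν t ∈ intrinsicInterior ℝ 𝒢 := by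
  cases t, ht using Nat.le_induction with
  | base => exact hν.mem
  | succ t ht =>
    rw [hν.step t ht]
    exact (hF.grad_gradient_dual _).1

/-- The costs need not lie in the direction space; the recursion for gradients sees only their
projections. -/
theorem grad_succ (hν : IsMirrorDescent 𝒢 F ρ f ν) (hF : IsRegularBarrier 𝒢 F)
    {t : ℕ} (ht : 1 ≤ t) :
    grad 𝒢 F (ν (t + 1))
      = grad 𝒢 F (ν t) - ρ • (vectorSpan ℝ 𝒢).starProjection (f t) := by
  rw [hν.step t ht, (hF.grad_gradient_dual _).2, map_sub, map_smul,
    Submodule.starProjection_eq_self_iff.2 grad_mem]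

/-- The regret of one step of mirror descent against a point of the relative interior. -/
theorem mul_inner_sub_eq (hν : IsMirrorDescent 𝒢 F ρ f ν) (hF : IsRegularBarrier 𝒢 F)
    {t : ℕ} (ht : 1 ≤ t) {μ : E} (hμ : μ ∈ intrinsicInterior ℝ 𝒢) :
    ρ * (inner ℝ (ν t) (f t) - inner ℝ μ (f t))
      = bregman 𝒢 F μ (ν t) - bregman 𝒢 F μ (ν (t + 1)) + bregman 𝒢 F (ν t) (ν (t + 1)) := by
  have h1 := hν.grad_succ hF ht
  have h2 : inner ℝ ((vectorSpan ℝ 𝒢).starProjection (f t)) (ν t - μ)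
      = inner ℝ (ν t) (f t) - inner ℝ μ (f t) := by
    rw [Submodule.inner_starProjection_left_eq_right, Submodule.starProjection_eq_self_iff.2
      (sub_mem_vectorSpan_of_mem_intrinsicInterior (hν.mem_intrinsicInterior hF ht) hμ),
      real_inner_comm, inner_sub_left]
  have h3 : inner ℝ (grad 𝒢 F (ν (t + 1))) (ν t - μ) = inner ℝ (grad 𝒢 F (ν t)) (ν t - μ)
      - ρ * (inner ℝ (ν t) (f t) - inner ℝ μ (f t)) := by
    rw [h1, inner_sub_left, real_inner_smul_left, h2]
  simp only [bregman]
  simp only [inner_sub_right] at h3 ⊢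
  linarith

theorem regret_le (hν : IsMirrorDescent 𝒢 F ρ f ν) (hF : IsRegularBarrier 𝒢 F) (hρ : 0 < ρ)
    {T : ℕ} (hf : ∀ t ∈ Finset.Icc 1 T, ρ * dualLocalNorm 𝒢 F (grad 𝒢 F (ν t)) (f t) ≤ 1 / 2)
    (hf' : ∀ t ∈ Finset.Icc 1 T, dualLocalNorm 𝒢 F (grad 𝒢 F (ν t)) (f t) ≤ 1)
    {μ : E} (hμ : μ ∈ intrinsicInterior ℝ 𝒢) :
    ∑ t ∈ Finset.Icc 1 T, inner ℝ (ν t) (f t) - ∑ t ∈ Finset.Icc 1 T, inner ℝ μ (f t)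
      ≤ bregman 𝒢 F μ (ν 1) / ρ + 2 * ρ * T := by
  have hstep : ∀ t ∈ Finset.Icc 1 T, ρ * (inner ℝ (ν t) (f t) - inner ℝ μ (f t))
      ≤ bregman 𝒢 F μ (ν t) - bregman 𝒢 F μ (ν (t + 1)) + 2 * ρ ^ 2 := by
    intro t ht
    have ht1 := (Finset.mem_Icc.1 ht).1
    rw [hν.mul_inner_sub_eq hF ht1 hμ]
    have h1 := hF.bregman_le (hν.mem_intrinsicInterior hF ht1)
      (hν.mem_intrinsicInterior hF (ht1.trans t.le_succ)) hρ.le (hν.grad_succ hF ht1) (hf t ht)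
    have h0 : 0 ≤ dualLocalNorm 𝒢 F (grad 𝒢 F (ν t)) (f t) := Real.sqrt_nonneg _
    have h2 : (ρ * dualLocalNorm 𝒢 F (grad 𝒢 F (ν t)) (f t)) ^ 2 ≤ ρ ^ 2 := by
      gcongr
      exact mul_le_of_le_one_right hρ.le (hf' t ht)
    linarith
  have hsum := Finset.sum_le_sum hstep
  have htel : ∑ t ∈ Finset.Icc 1 T, (bregman 𝒢 F μ (ν t) - bregman 𝒢 F μ (ν (t + 1)))
      = bregman 𝒢 F μ (ν 1) - bregman 𝒢 F μ (ν (T + 1)) := by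
    rw [← Finset.Ico_add_one_right_eq_Icc, ← neg_inj, ← Finset.sum_neg_distrib]
    simp only [neg_sub]
    exact Finset.sum_Ico_sub (fun t => bregman 𝒢 F μ (ν t)) (Nat.le_add_left 1 T)
  rw [← Finset.mul_sum, Finset.sum_sub_distrib, Finset.sum_add_distrib, htel, Finset.sum_const,
    Nat.card_Icc, nsmul_eq_mul, add_tsub_cancel_right] at hsum
  -- The final divergence left by the telescoping enters with a minus sign and can be dropped.
  have hlast := hF.bregman_nonneg hμ (hν.mem_intrinsicInterior hF (Nat.le_add_left 1 T))
  rw [← mul_le_mul_iff_right₀ hρ, mul_add, mul_div_cancel₀ _ hρ.ne']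
  linarith

end IsMirrorDescent

end Regret

end OnlineMDP

/-! ### The regret bound in extended reals. -/

theorem theorem6 {S A : Type*} [Fintype S] [Fintype A]
    (K : S → A → S → ℝ) (hK : OnlineMDP.IsTransitionLaw K)
    (𝒢 : Set (EuclideanSpace ℝ (S × A))) (h𝒢 : 𝒢 = OnlineMDP.stateActionPolytope K)
    (F : EuclideanSpace ℝ (S × A) → ℝ) (hF : OnlineMDP.IsRegularBarrier 𝒢 F)
    (𝒢' : Set (EuclideanSpace ℝ (S × A))) (h𝒢' : 𝒢' ⊆ intrinsicInterior ℝ 𝒢)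
    (T : ℕ) (ρ : ℝ) (hρ : 0 < ρ)
    (f ν : ℕ → EuclideanSpace ℝ (S × A))
    (hν : OnlineMDP.IsMirrorDescent 𝒢 F ρ f ν)
    (hf : ∀ t ∈ Finset.Icc 1 T,
      ρ * OnlineMDP.dualLocalNorm 𝒢 F (OnlineMDP.grad 𝒢 F (ν t)) (f t) ≤ 1 / 2)
    (hf' : ∀ t ∈ Finset.Icc 1 T,
      OnlineMDP.dualLocalNorm 𝒢 F (OnlineMDP.grad 𝒢 F (ν t)) (f t) ≤ 1) :
    ((∑ t ∈ Finset.Icc 1 T, inner ℝ (ν t) (f t) : ℝ) : EReal)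
        - ⨅ μ ∈ 𝒢', ((∑ t ∈ Finset.Icc 1 T, inner ℝ μ (f t) : ℝ) : EReal)
      ≤ OnlineMDP.bregmanSup 𝒢 F 𝒢' (ν 1) / ((ρ : ℝ) : EReal)
        + ((2 * ρ * T : ℝ) : EReal) := by
  rcases 𝒢'.eq_empty_or_nonempty with rfl | ⟨μ₀, hμ₀⟩
  -- The infimum over the empty set is `⊤`, so the left side is `⊥`.
  · simp
  have key : ∀ μ ∈ 𝒢', ((∑ t ∈ Finset.Icc 1 T, inner ℝ (ν t) (f t)
      - ∑ t ∈ Finset.Icc 1 T, inner ℝ μ (f t) : ℝ) : EReal)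
      ≤ OnlineMDP.bregmanSup 𝒢 F 𝒢' (ν 1) / ((ρ : ℝ) : EReal)
        + ((2 * ρ * T : ℝ) : EReal) := by
    intro μ hμ
    have h1 := EReal.coe_le_coe_iff.2 (hν.regret_le hF hρ hf hf' (h𝒢' hμ))
    rw [EReal.coe_add, EReal.coe_div] at h1
    refine h1.trans (add_le_add_left (EReal.div_le_div_right_of_nonneg ?_ ?_) _)
    · exact_mod_cast hρ.le
    · exact le_iSup₂ (f := fun ν' (_ : ν' ∈ 𝒢') =>
        ((OnlineMDP.bregman 𝒢 F ν' (ν 1) : ℝ) : EReal)) μ hμ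
  -- The bound on the right does not depend on `μ`. It is not `⊥` because it dominates a real number
  -- at `μ₀`; when finite, it can be moved across the infimum.
  generalize OnlineMDP.bregmanSup 𝒢 F 𝒢' (ν 1) / ((ρ : ℝ) : EReal)
    + ((2 * ρ * T : ℝ) : EReal) = c at key ⊢
  induction c with
  | bot => exact absurd (le_bot_iff.1 (key μ₀ hμ₀)) (EReal.coe_ne_bot _)
  | top => exact le_top
  | coe c =>
    rw [EReal.sub_le_iff_le_add (Or.inr (EReal.coe_ne_top c)) (Or.inr (EReal.coe_ne_bot c)),
      add_comm, ← EReal.sub_le_iff_le_add (Or.inl (EReal.coe_ne_bot c))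
        (Or.inl (EReal.coe_ne_top c))]
    refine le_iInf₂ fun μ hμ => ?_
    have := EReal.coe_le_coe_iff.1 (key μ hμ)
    rw [← EReal.coe_sub, EReal.coe_le_coe_iff]
    linarith
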